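/- Let $G_{4,2}(\mathbb{R})$ be the Grassmann manifold of all $2$-dimensional linear subspaces of $\mathbb{R}^4$, with its usual topology (the quotient topology from the space of linearly independent pairs of vectors in $\mathbb{R}^4$). Let $\mathbb{Z}_2^4=\{\pm1\}^4$ act on $G_{4,2}(\mathbb{R})$ through its coordinatewise action $(t_1,\dots,t_4)\cdot(v_1,\dots,v_4)=(t_1v_1,\dots,t_4v_4)$ on $\mathbb{R}^4$, and let $X(\mathbb{R})=G_{4,2}(\mathbb{R})/\mathbb{Z}_2^4$ be the orbit space with the quotient topology. Let $$\Delta_{4,2}=\Bigl\{x\in\mathbb{R}^4 : 0\le x_i\le 1\ (1\le i\le 4),\ \sum_{i=1}^4 x_i=2\Bigr\}$$ be the hypersimplex (an octahedron), let $\partial\Delta_{4,2}$ be its boundary relative to its affine hull, and let $\approx$ be the equivalence relation on $\Delta_{4,2}\times\mathbb{R}P^1$ for which two distinct points $(x,r)$ and $(y,r')$ are equivalent if and only if $x=y\in\partial\Delta_{4,2}$. Let $S^d$ be the unit sphere in $\mathbb{R}^{d+1}$. For nonempty topological spaces $A$ and $B$, the join $A*B$ is the quotient of $A\times[0,1]\times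 B$ by the identifications $(a,0,b)\sim(a,0,b')$ and $(a,1,b)\sim(a',1,b)$ for all $a,a'\in A$ and $b,b'\in B$. Then the following hold. 1. $X(\mathbb{R})$ is homeomorphic to the quotient space $(\Delta_{4,2}\times\mathbb{R}P^1)/\approx$. 2. $X(\mathbb{R})$ is homeomorphic to the join $S^2*S^1$. 3. $X(\mathbb{R})$ is homeomorphic to the sphere $S^4$. -/

import Mathlib

open scoped LinearAlgebra.Projectivization

/-- The real Grassmann manifold `G_{n,k}(ℝ)` of all `k`-dimensional linear subspaces of `ℝⁿ`. -/
def RealGrassmannian (n k : ℕ) : Type :=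
  {V : Submodule ℝ (Fin n → ℝ) // Module.finrank ℝ V = k}

namespace RealGrassmannian

/-- The space of (arbitrary, not necessarily orthonormal) `k`-frames in `ℝⁿ`,
with the subspace topology of `(ℝⁿ)ᵏ`. -/
abbrev Frame (n k : ℕ) : Type :=
  {v : Fin k → Fin n → ℝ // LinearIndependent ℝ v}

/-- The subspace spanned by a frame. -/
noncomputable def ofFrame {n k : ℕ} (v : Frame n k) : RealGrassmannian n k :=
  ⟨Submodule.span ℝ (Set.range v.1), by simpa using finrank_span_eq_card v.2⟩

theorem ofFrame_surjective {n k : ℕ} :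
    Function.Surjective (ofFrame : Frame n k → RealGrassmannian n k) := by
  rintro ⟨V, hV⟩
  let b := Module.finBasisOfFinrankEq ℝ V hV
  refine ⟨⟨fun i => (b i : Fin n → ℝ), b.linearIndependent.map' V.subtype V.ker_subtype⟩, ?_⟩
  apply Subtype.ext
  change Submodule.span ℝ (Set.range fun i => (b i : Fin n → ℝ)) = V
  have h : (Set.range fun i => (b i : Fin n → ℝ)) = V.subtype '' Set.range b := by
    rw [← Set.range_comp]; rfl
  rw [h, Submodule.span_image, b.span_eq, Submodule.map_top, Submodule.range_subtype]

/-- The usual topology of the Grassmann manifold: the quotient topology of the space of frames. -/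
noncomputable instance topology (n k : ℕ) : TopologicalSpace (RealGrassmannian n k) :=
  TopologicalSpace.coinduced ofFrame inferInstance

/-- The diagonal linear map `(v₁, …, vₙ) ↦ (t₁ v₁, …, tₙ vₙ)` of `ℝⁿ`, for signs `tᵢ = ±1`. -/
noncomputable def signMap {n : ℕ} (t : Fin n → ℤˣ) : (Fin n → ℝ) →ₗ[ℝ] (Fin n → ℝ) where
  toFun v := fun i => ((t i : ℤ) : ℝ) * v i
  map_add' v w := by
    funext i
    exact mul_add _ _ _
  map_smul' c v := by
    funext i
    exact mul_left_comm _ _ _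

theorem signMap_one {n : ℕ} : signMap (1 : Fin n → ℤˣ) = LinearMap.id := by
  ext v i
  simp [signMap]

theorem signMap_mul {n : ℕ} (s t : Fin n → ℤˣ) : signMap (s * t) = signMap s ∘ₗ signMap t := by
  ext v i
  simp [signMap, mul_assoc]

theorem signMap_injective {n : ℕ} (t : Fin n → ℤˣ) : Function.Injective (signMap t) := by
  intro v w h
  have h2 : signMap (t⁻¹ * t) v = signMap (t⁻¹ * t) w := by
    rw [signMap_mul, LinearMap.comp_apply, LinearMap.comp_apply, h]
  simpa [signMap_one] using h2

/-- The action of `ℤ₂ⁿ = {±1}ⁿ` on `G_{n,k}(ℝ)` induced by its diagonal action on `ℝⁿ`: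
a subspace is sent to its image. -/
noncomputable instance signAction (n k : ℕ) : MulAction (Fin n → ℤˣ) (RealGrassmannian n k) where
  smul t V := ⟨V.1.map (signMap t),
    (V.1.equivMapOfInjective (signMap t) (signMap_injective t)).finrank_eq.symm.trans V.2⟩
  one_smul V := Subtype.ext (by
    change V.1.map (signMap 1) = V.1
    rw [signMap_one, Submodule.map_id])
  mul_smul s t V := Subtype.ext (by
    change V.1.map (signMap (s * t)) = (V.1.map (signMap t)).map (signMap s)
    rw [signMap_mul, Submodule.map_comp])

end RealGrassmannian

/-- The orbit space `G_{n,k}(ℝ) / ℤ₂ⁿ`, with the quotient topology. -/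
abbrev SignOrbitSpace (n k : ℕ) : Type :=
  MulAction.orbitRel.Quotient (Fin n → ℤˣ) (RealGrassmannian n k)

/-- The hypersimplex `Δ_{n,k}`, a convex polytope in `ℝⁿ`. -/
def hypersimplex (n k : ℕ) : Set (Fin n → ℝ) :=
  {x | (∀ i, 0 ≤ x i ∧ x i ≤ 1) ∧ ∑ i, x i = (k : ℝ)}

/-- The usual topology of a real projective space: the quotient topology of `V ∖ {0}`. -/
noncomputable instance realProjectiveTopology (m : ℕ) : TopologicalSpace (ℙ ℝ (Fin m → ℝ)) :=
  TopologicalSpace.coinduced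
    (fun v : {v : Fin m → ℝ // v ≠ 0} => Projectivization.mk ℝ v.1 v.2) inferInstance

/-- For a subset `D` of a real vector space (in practice a convex polytope) and a space `F`, the
equivalence relation on `D × F` that identifies `(x, r)` with `(x, r')` for all `r`, `r'` in `F`
whenever `x` lies in the boundary of `D` (taken in the affine hull of `D`). -/
def boundarySetoid {E : Type*} [AddCommGroup E] [Module ℝ E] [TopologicalSpace E]
    (D : Set E) (F : Type*) : Setoid (D × F) where
  r p q := p = q ∨ (p.1 = q.1 ∧ (p.1 : E) ∈ intrinsicFrontier ℝ D)
  iseqv := by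
    refine ⟨fun p => Or.inl rfl, ?_, ?_⟩
    · rintro p q (h | ⟨h, hb⟩)
      · exact Or.inl h.symm
      · exact Or.inr ⟨h.symm, h ▸ hb⟩
    · rintro p q r (rfl | ⟨h, hb⟩) h2
      · exact h2
      · rcases h2 with rfl | ⟨h3, _⟩
        · exact Or.inr ⟨h, hb⟩
        · exact Or.inr ⟨h.trans h3, hb⟩

/-- The equivalence relation on `X × [0,1] × Y` that identifies `(x, 0, y)` with `(x, 0, y')`
and `(x, 1, y)` with `(x', 1, y)`. -/
def joinSetoid (X Y : Type*) : Setoid (X × unitInterval × Y) where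
  r p q := p = q ∨ (p.2.1 = 0 ∧ q.2.1 = 0 ∧ p.1 = q.1) ∨ (p.2.1 = 1 ∧ q.2.1 = 1 ∧ p.2.2 = q.2.2)
  iseqv := by
    refine ⟨fun p => Or.inl rfl, ?_, ?_⟩
    · rintro p q (h | ⟨h1, h2, h3⟩ | ⟨h1, h2, h3⟩)
      · exact Or.inl h.symm
      · exact Or.inr (Or.inl ⟨h2, h1, h3.symm⟩)
      · exact Or.inr (Or.inr ⟨h2, h1, h3.symm⟩)
    · rintro p q r (rfl | ⟨h1, h2, h3⟩ | ⟨h1, h2, h3⟩) h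
      · exact h
      · rcases h with rfl | ⟨_, h5, h6⟩ | ⟨h4, _, _⟩
        · exact Or.inr (Or.inl ⟨h1, h2, h3⟩)
        · exact Or.inr (Or.inl ⟨h1, h5, h3.trans h6⟩)
        · exact absurd (h2.symm.trans h4) zero_ne_one
      · rcases h with rfl | ⟨h4, _, _⟩ | ⟨_, h5, h6⟩
        · exact Or.inr (Or.inr ⟨h1, h2, h3⟩)
        · exact absurd (h4.symm.trans h2) zero_ne_one
        · exact Or.inr (Or.inr ⟨h1, h5, h3.trans h6⟩)

/-- The topological join `X * Y` (of nonempty spaces), with the quotient topology. -/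
abbrev TopJoin (X Y : Type*) [TopologicalSpace X] [TopologicalSpace Y] :=
  Quotient (joinSetoid X Y)

/-- The unit sphere `Sᵈ` in Euclidean space `ℝᵈ⁺¹`. -/
abbrev unitSphere (d : ℕ) : Type :=
  Metric.sphere (0 : EuclideanSpace ℝ (Fin (d + 1))) 1

/-! All three spaces are shown to be `S⁴` by one device, radial projection in `ℝ³ × ℂ = ℝ⁵`. Each is
a compact quotient of a space carrying a continuous map to `ℝ⁵ ∖ {0}` that meets every open ray and
whose values lie on a common ray exactly at identified points. The induced continuous bijection from
a compact space onto a Hausdorff sphere is a homeomorphism (`nonempty_homeomorph_unitSphere`).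

For the join the map is `((1 - t) a, t b)`. For the octahedron, an `ℓ¹` ball, the interior has an
`ℝP¹` factor that becomes a circle of radius `1 - octNorm x`.

For the Grassmannian, let `pᵢⱼ` be the Plücker coordinates and `A`, `B`, `C` the products `p₀₁p₂₃`,
`p₀₂p₁₃`, `p₀₃p₁₂`, so that `B = A + C`. The sign group multiplies `pᵢⱼ` by `tᵢtⱼ`, hence fixes all
squares and multiplies `A`, `B`, `C` by the common sign `t₀t₁t₂t₃`. The invariants `p₀₁² - p₂₃²`,
`p₀₂² - p₁₃²`, `p₀₃² - p₁₂²` and `±(A + iC)` are complete: `p² - q²` and `(pq)²` determine `p²` and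
`q²`, and the remaining signs are realised by the group and a rescaling (`exists_signs_of_minors`).
Doubling the angle turns `±(A + iC)` into a point of `ℂ`. -/

/-- A compact quotient of `A` is a sphere as soon as `A` maps to the punctured Euclidean space,
meeting all open rays, and the fibres of the quotient map are the preimages of the open rays. -/
theorem nonempty_homeomorph_unitSphere {A X : Type*} [TopologicalSpace A] [TopologicalSpace X]
    [CompactSpace X] {d : ℕ} {π : A → X} (hπ : Topology.IsQuotientMap π)
    {Φ : A → EuclideanSpace ℝ (Fin (d + 1))} (hc : Continuous Φ) (h0 : ∀ a, Φ a ≠ 0)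
    (hs : ∀ y, y ≠ 0 → ∃ a, ∃ k : ℝ, 0 < k ∧ Φ a = k • y)
    (hk : ∀ a b, π a = π b ↔ ∃ k : ℝ, 0 < k ∧ Φ b = k • Φ a) :
    Nonempty (X ≃ₜ unitSphere d) := by
  have hpos : ∀ a, 0 < ‖Φ a‖ := fun a => norm_pos_iff.2 (h0 a)
  let Ψ : A → unitSphere d := fun a => ⟨‖Φ a‖⁻¹ • Φ a, by
    rw [mem_sphere_zero_iff_norm, norm_smul, norm_inv, norm_norm, inv_mul_cancel₀ (hpos a).ne']⟩
  have hΨc : Continuous Ψ :=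
    Continuous.subtype_mk ((hc.norm.inv₀ fun a => (hpos a).ne').smul hc) _
  have hΨs : Function.Surjective Ψ := by
    rintro ⟨y, hy⟩
    have hy1 : ‖y‖ = 1 := mem_sphere_zero_iff_norm.1 hy
    obtain ⟨a, k, hk0, ha⟩ := hs y (by rintro rfl; simp at hy1)
    refine ⟨a, Subtype.ext ?_⟩
    change ‖Φ a‖⁻¹ • Φ a = y
    rw [ha, norm_smul, hy1, mul_one, Real.norm_of_nonneg hk0.le, smul_smul,
      inv_mul_cancel₀ hk0.ne', one_smul]
  have hker : ∀ a b, π a = π b ↔ Ψ a = Ψ b := by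
    intro a b
    rw [hk]
    constructor
    · rintro ⟨k, hk0, h⟩
      apply Subtype.ext
      change ‖Φ a‖⁻¹ • Φ a = ‖Φ b‖⁻¹ • Φ b
      rw [h, norm_smul, Real.norm_of_nonneg hk0.le, smul_smul, mul_inv, mul_right_comm,
        inv_mul_cancel₀ hk0.ne', one_mul]
    · intro h
      have h' : ‖Φ a‖⁻¹ • Φ a = ‖Φ b‖⁻¹ • Φ b := congrArg Subtype.val h
      refine ⟨‖Φ b‖ * ‖Φ a‖⁻¹, mul_pos (hpos b) (inv_pos.2 (hpos a)), ?_⟩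
      rw [mul_smul, h', smul_smul, mul_inv_cancel₀ (hpos b).ne', one_smul]
  let g : X → unitSphere d := fun x => Ψ (Function.surjInv hπ.surjective x)
  have hg : ∀ a, g (π a) = Ψ a := fun a =>
    (hker _ _).1 (Function.surjInv_eq hπ.surjective (π a))
  have hgc : Continuous g := hπ.continuous_iff.2 (by
    rw [show g ∘ π = Ψ from funext hg]
    exact hΨc)
  have hgb : Function.Bijective g := by
    constructor
    · intro x y h
      obtain ⟨a, rfl⟩ := hπ.surjective x
      obtain ⟨b, rfl⟩ := hπ.surjective y
      rw [hg, hg] at h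
      exact (hker a b).2 h
    · intro y
      obtain ⟨a, rfl⟩ := hΨs y
      exact ⟨π a, hg a⟩
  exact ⟨Continuous.homeoOfEquivCompactToT2 (f := Equiv.ofBijective g hgb) hgc⟩

/-! ### Coordinates on `ℝ³ × ℂ` -/

/-- The vector `(a, b, c, w)` of `ℝ³ × ℂ = ℝ⁵`. -/
def realComplexVec (a b c : ℝ) (w : ℂ) : EuclideanSpace ℝ (Fin 5) :=
  !₂[a, b, c, w.re, w.im]

theorem realComplexVec_inj {a b c a' b' c' : ℝ} {w w' : ℂ} :
    realComplexVec a b c w = realComplexVec a' b' c' w' ↔ a = a' ∧ b = b' ∧ c = c' ∧ w = w' := by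
  constructor
  · intro h
    have h' : ∀ i, realComplexVec a b c w i = realComplexVec a' b' c' w' i := fun i => by rw [h]
    exact ⟨by simpa [realComplexVec] using h' 0, by simpa [realComplexVec] using h' 1,
      by simpa [realComplexVec] using h' 2, Complex.ext (by simpa [realComplexVec] using h' 3)
        (by simpa [realComplexVec] using h' 4)⟩
  · rintro ⟨rfl, rfl, rfl, rfl⟩
    rfl

theorem realComplexVec_zero : realComplexVec 0 0 0 0 = 0 := by
  ext i
  fin_cases i <;> simp [realComplexVec]

theorem smul_realComplexVec (k a b c : ℝ) (w : ℂ) :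
    k • realComplexVec a b c w = realComplexVec (k * a) (k * b) (k * c) (k * w) := by
  ext i
  fin_cases i <;> simp [realComplexVec]

theorem exists_eq_realComplexVec (y : EuclideanSpace ℝ (Fin 5)) :
    ∃ a b c w, y = realComplexVec a b c w := by
  refine ⟨y 0, y 1, y 2, ⟨y 3, y 4⟩, ?_⟩
  ext i
  fin_cases i <;> simp [realComplexVec]

theorem Continuous.realComplexVec {A : Type*} [TopologicalSpace A] {a b c : A → ℝ} {w : A → ℂ}
    (ha : Continuous a) (hb : Continuous b) (hc : Continuous c) (hw : Continuous w) :
    Continuous fun x => realComplexVec (a x) (b x) (c x) (w x) := by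
  unfold _root_.realComplexVec
  refine (PiLp.continuous_toLp 2 _).comp (continuous_pi fun i => ?_)
  fin_cases i
  · exact ha
  · exact hb
  · exact hc
  · exact Complex.continuous_re.comp hw
  · exact Complex.continuous_im.comp hw

/-! ### Angle doubling -/

/-- The homogeneous map `z ↦ z² / |z|`, which doubles angles. -/
noncomputable def angleDouble (z : ℂ) : ℂ := z ^ 2 / ‖z‖

theorem norm_angleDouble (z : ℂ) : ‖angleDouble z‖ = ‖z‖ := by
  rcases eq_or_ne z 0 with rfl | hz
  · simp [angleDouble]
  · have := norm_pos_iff.2 hz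
    simp only [angleDouble, norm_div, norm_pow, Complex.norm_real, norm_norm]
    field_simp

/-- Only the origin needs care: there `0 / 0 = 0` is the right value, because the map preserves
norms. -/
theorem continuous_angleDouble : Continuous angleDouble := by
  rw [continuous_iff_continuousAt]
  intro z
  rcases eq_or_ne z 0 with rfl | hz
  · have h0 : angleDouble 0 = 0 := by simp [angleDouble]
    rw [ContinuousAt, h0]
    apply tendsto_zero_iff_norm_tendsto_zero.2
    simp only [norm_angleDouble]
    simpa using (continuous_norm (E := ℂ)).tendsto 0
  · have : (‖z‖ : ℂ) ≠ 0 := by simpa using hz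
    exact ContinuousAt.div (by fun_prop) (by fun_prop) this

/-- The absolute value is the point: real scalars act through their size, so a common sign of the
products of complementary minors disappears. -/
theorem angleDouble_real_mul (k : ℝ) (z : ℂ) : angleDouble (k * z) = |k| * angleDouble z := by
  rcases eq_or_ne k 0 with rfl | hk
  · simp [angleDouble]
  have h1 : ((|k| : ℝ) : ℂ) ≠ 0 := by simpa using hk
  have h2 : ((|k| : ℝ) : ℂ) ^ 2 = (k : ℂ) ^ 2 := by
    rw [← Complex.ofReal_pow, sq_abs, Complex.ofReal_pow]
  rw [angleDouble, angleDouble, norm_mul, Complex.norm_real, Real.norm_eq_abs, Complex.ofReal_mul,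
    mul_pow, ← h2]
  rcases eq_or_ne z 0 with rfl | hz
  · simp
  have h3 : (‖z‖ : ℂ) ≠ 0 := by simpa using hz
  field_simp

theorem angleDouble_eq_iff {z z' : ℂ} : angleDouble z = angleDouble z' ↔ z = z' ∨ z = -z' := by
  constructor
  · intro h
    have hn : ‖z‖ = ‖z'‖ := by rw [← norm_angleDouble, h, norm_angleDouble]
    rcases eq_or_ne z' 0 with rfl | hz
    · left
      simpa using hn
    · have h3 : (‖z'‖ : ℂ) ≠ 0 := by simpa using hz
      rw [angleDouble, angleDouble, hn, div_left_inj' h3] at h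
      exact sq_eq_sq_iff_eq_or_eq_neg.1 h
  · rintro (rfl | rfl)
    · rfl
    · simp [angleDouble]

theorem angleDouble_surjective : Function.Surjective angleDouble := by
  intro w
  obtain ⟨z, hz⟩ := IsAlgClosed.exists_pow_nat_eq (w * ‖w‖) (n := 2) two_pos
  refine ⟨z, ?_⟩
  have hn : ‖z‖ = ‖w‖ := by
    have := congrArg norm hz
    rw [norm_pow, norm_mul, Complex.norm_real, norm_norm, ← sq] at this
    exact (pow_left_inj₀ (norm_nonneg _) (norm_nonneg _) two_ne_zero).1 this
  rw [angleDouble, hz, hn]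
  rcases eq_or_ne w 0 with rfl | hw
  · simp
  have h3 : (‖w‖ : ℂ) ≠ 0 := by simpa using hw
  field_simp

/-! ### The join of `S²` and `S¹` -/

theorem norm_sq_fin_three (a : EuclideanSpace ℝ (Fin 3)) :
    ‖a‖ ^ 2 = a 0 ^ 2 + a 1 ^ 2 + a 2 ^ 2 := by
  simp [EuclideanSpace.norm_sq_eq, Fin.sum_univ_three]

theorem norm_sq_fin_two (a : EuclideanSpace ℝ (Fin 2)) : ‖a‖ ^ 2 = a 0 ^ 2 + a 1 ^ 2 := by
  simp [EuclideanSpace.norm_sq_eq, Fin.sum_univ_two]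

theorem unitSphere_two_sq (a : unitSphere 2) :
    a.1 0 ^ 2 + a.1 1 ^ 2 + a.1 2 ^ 2 = 1 := by
  rw [← norm_sq_fin_three, mem_sphere_zero_iff_norm.1 a.2, one_pow]

/-- The circle as a subset of `ℂ`. -/
def circleComplex (b : unitSphere 1) : ℂ := ⟨b.1 0, b.1 1⟩

theorem norm_circleComplex (b : unitSphere 1) : ‖circleComplex b‖ = 1 := by
  have h : b.1 0 ^ 2 + b.1 1 ^ 2 = 1 := by
    rw [← norm_sq_fin_two, mem_sphere_zero_iff_norm.1 b.2, one_pow]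
  have h3 : ‖circleComplex b‖ ^ 2 = 1 := by
    rw [← Complex.normSq_eq_norm_sq, Complex.normSq_apply, ← h]
    simp only [circleComplex]
    ring
  exact (pow_eq_one_iff_of_nonneg (norm_nonneg _) two_ne_zero).1 h3

theorem circleComplex_injective : Function.Injective circleComplex := by
  intro b b' h
  have h0 := congrArg Complex.re h
  have h1 := congrArg Complex.im h
  simp only [circleComplex] at h0 h1
  apply Subtype.ext
  ext i
  fin_cases i
  · exact h0
  · exact h1

theorem exists_circleComplex_eq {w : ℂ} (hw : ‖w‖ = 1) : ∃ b, circleComplex b = w := by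
  refine ⟨⟨!₂[w.re, w.im], ?_⟩, by simp [circleComplex]⟩
  rw [mem_sphere_zero_iff_norm]
  have h3 : ‖(!₂[w.re, w.im] : EuclideanSpace ℝ (Fin 2))‖ ^ 2 = 1 := by
    have : ‖w‖ ^ 2 = 1 := by rw [hw, one_pow]
    rw [← Complex.normSq_eq_norm_sq, Complex.normSq_apply] at this
    rw [norm_sq_fin_two, ← this]
    simp [sq]
  exact (pow_eq_one_iff_of_nonneg (norm_nonneg _) two_ne_zero).1 h3

theorem continuous_circleComplex : Continuous circleComplex := by
  have h : ∀ i, Continuous fun b : unitSphere 1 => b.1 i := fun i => by fun_prop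
  exact Complex.equivRealProdCLM.symm.continuous.comp ((h 0).prodMk (h 1))

/-- The map `(a, t, b) ↦ ((1 - t) a, t b)` from `S² × [0,1] × S¹` to `ℝ³ × ℂ`. -/
noncomputable def joinVec (p : unitSphere 2 × unitInterval × unitSphere 1) :
    EuclideanSpace ℝ (Fin 5) :=
  realComplexVec ((1 - p.2.1) * p.1.1 0) ((1 - p.2.1) * p.1.1 1) ((1 - p.2.1) * p.1.1 2)
    ((p.2.1 : ℝ) * circleComplex p.2.2)

theorem continuous_joinVec : Continuous joinVec := by
  have h := continuous_circleComplex
  unfold joinVec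
  apply Continuous.realComplexVec <;> fun_prop

/-- The two components of `joinVec` have norms `1 - t` and `t`, with sum `1`, which forces `k = 1`.
The factors `1 - t` and `t` stay in the conclusion since at the ends of the join one of the points
is undetermined. -/
theorem joinVec_eq_smul {p q : unitSphere 2 × unitInterval × unitSphere 1} {k : ℝ} (hk : 0 < k)
    (h : joinVec q = k • joinVec p) :
    q.2.1 = p.2.1 ∧ (∀ i, (1 - p.2.1 : ℝ) * q.1.1 i = (1 - p.2.1) * p.1.1 i) ∧
      (p.2.1 : ℝ) * circleComplex q.2.2 = (p.2.1 : ℝ) * circleComplex p.2.2 := by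
  obtain ⟨a, s, b⟩ := p
  obtain ⟨a', s', b'⟩ := q
  rw [joinVec, joinVec, smul_realComplexVec, realComplexVec_inj] at h
  obtain ⟨h0, h1, h2, h3⟩ := h
  simp only at h0 h1 h2 h3 ⊢
  have hs := s.2.1
  have hs1 := s.2.2
  have hs' := s'.2.1
  have hs1' := s'.2.2
  have e1 : (s' : ℝ) = k * s := by
    have := congrArg norm h3
    simp only [norm_mul, norm_circleComplex, Complex.norm_real, Real.norm_eq_abs, mul_one,
      abs_of_nonneg hs, abs_of_nonneg hs', abs_of_pos hk] at this
    exact this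
  have e2 : (1 - s' : ℝ) = k * (1 - s) := by
    have ha := unitSphere_two_sq a
    have ha' := unitSphere_two_sq a'
    have : (1 - s' : ℝ) ^ 2 = (k * (1 - s)) ^ 2 := by
      calc (1 - s' : ℝ) ^ 2 = ((1 - s') * a'.1 0) ^ 2 + ((1 - s') * a'.1 1) ^ 2
            + ((1 - s') * a'.1 2) ^ 2 := by linear_combination (-(1 - s' : ℝ) ^ 2) * ha'
        _ = _ := by rw [h0, h1, h2]; linear_combination ((k * (1 - s)) ^ 2) * ha
    exact (pow_left_inj₀ (by linarith) (mul_nonneg hk.le (by linarith)) two_ne_zero).1 this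
  have hk1 : k = 1 := by linarith
  subst hk1
  have e3 : s' = s := Subtype.ext (by linarith)
  subst e3
  refine ⟨rfl, ?_, by simpa using h3⟩
  intro i
  fin_cases i
  · simpa using h0
  · simpa using h1
  · simpa using h2

theorem nonempty_topJoin_homeomorph :
    Nonempty (TopJoin (unitSphere 2) (unitSphere 1) ≃ₜ unitSphere 4) := by
  refine nonempty_homeomorph_unitSphere (π := Quotient.mk _) isQuotientMap_quotient_mk'
    continuous_joinVec ?_ ?_ ?_
  · rintro ⟨a, s, b⟩ h
    rw [joinVec, ← realComplexVec_zero, realComplexVec_inj] at h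
    obtain ⟨h0, h1, h2, h3⟩ := h
    have hs : (s : ℝ) = 0 := by
      have := congrArg norm h3
      simpa [norm_circleComplex] using this
    simp only [hs] at h0 h1 h2
    have := unitSphere_two_sq a
    simp only [sub_zero, one_mul] at h0 h1 h2
    rw [h0, h1, h2] at this
    norm_num at this
  · intro y hy
    obtain ⟨u0, u1, u2, w, rfl⟩ := exists_eq_realComplexVec y
    -- Polar coordinates for both components; the direction of a zero component is arbitrary.
    obtain ⟨a, ha⟩ : ∃ a : unitSphere 2, ∀ i, ‖(!₂[u0, u1, u2] : EuclideanSpace ℝ (Fin 3))‖ * a.1 i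
        = (!₂[u0, u1, u2] : EuclideanSpace ℝ (Fin 3)) i := by
      set u : EuclideanSpace ℝ (Fin 3) := !₂[u0, u1, u2]
      rcases eq_or_ne u 0 with hu | hu
      · exact ⟨⟨EuclideanSpace.single 0 1, by simp⟩, fun i => by simp [hu]⟩
      · have := (norm_pos_iff.2 hu).ne'
        refine ⟨⟨‖u‖⁻¹ • u, by simp [norm_smul, this]⟩, fun i => ?_⟩
        simp only [PiLp.smul_apply, smul_eq_mul]
        field_simp
    obtain ⟨b, hb⟩ : ∃ b, (‖w‖ : ℂ) * circleComplex b = w := by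
      rcases eq_or_ne w 0 with hw | hw
      · obtain ⟨b, -⟩ := exists_circleComplex_eq (w := 1) (by simp)
        exact ⟨b, by simp [hw]⟩
      · have h3 : (‖w‖ : ℂ) ≠ 0 := by simpa using hw
        obtain ⟨b, hb⟩ := exists_circleComplex_eq (w := w / ‖w‖) (by
          rw [norm_div, Complex.norm_real, norm_norm, div_self (norm_ne_zero_iff.2 hw)])
        exact ⟨b, by rw [hb]; field_simp⟩
    set n := ‖(!₂[u0, u1, u2] : EuclideanSpace ℝ (Fin 3))‖ with hn
    have hn0 : 0 ≤ n := norm_nonneg _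
    have hw0 : 0 ≤ ‖w‖ := norm_nonneg _
    have e0 : n * a.1 0 = u0 := ha 0
    have e1 : n * a.1 1 = u1 := ha 1
    have e2 : n * a.1 2 = u2 := ha 2
    have hG : 0 < n + ‖w‖ := by
      refine lt_of_le_of_ne (by linarith) fun h => hy ?_
      have hn1 : n = 0 := by linarith
      have hw1 : ‖w‖ = 0 := by linarith
      rw [← e0, ← e1, ← e2, norm_eq_zero.1 hw1, hn1]
      simpa using realComplexVec_zero
    -- The point of the ray where the norms of the two components add up to `1`.
    refine ⟨(a, ⟨‖w‖ / (n + ‖w‖), by positivity, by rw [div_le_one hG]; linarith⟩, b),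
      (n + ‖w‖)⁻¹, inv_pos.2 hG, ?_⟩
    have hG' : (n + ‖w‖ : ℂ) ≠ 0 := by exact_mod_cast hG.ne'
    rw [joinVec, smul_realComplexVec, realComplexVec_inj]
    simp only
    refine ⟨?_, ?_, ?_, ?_⟩
    · rw [← e0]; field_simp; ring
    · rw [← e1]; field_simp; ring
    · rw [← e2]; field_simp; ring
    · push_cast
      rw [div_eq_inv_mul, mul_assoc, hb]
  · rintro p q
    rw [Quotient.eq]
    constructor
    · rintro (rfl | ⟨h1, h2, h3⟩ | ⟨h1, h2, h3⟩)
      · exact ⟨1, one_pos, (one_smul _ _).symm⟩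
      · refine ⟨1, one_pos, ?_⟩
        rw [one_smul, joinVec, joinVec, h1, h2, h3]
        simp
      · refine ⟨1, one_pos, ?_⟩
        rw [one_smul, joinVec, joinVec, h1, h2, h3]
        simp
    · rintro ⟨k, hk, h⟩
      obtain ⟨h1, h2, h3⟩ := joinVec_eq_smul hk h
      have hX : p.2.1 ≠ 1 → p.1 = q.1 := by
        intro hne
        have : (1 - p.2.1 : ℝ) ≠ 0 := fun h => hne (Subtype.ext (by simpa using (sub_eq_zero.1 h).symm))
        exact Subtype.ext (PiLp.ext fun i => (mul_left_cancel₀ this (h2 i)).symm)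
      have hY : p.2.1 ≠ 0 → p.2.2 = q.2.2 := by
        intro hne
        have : ((p.2.1 : ℝ) : ℂ) ≠ 0 := fun h => hne (Subtype.ext (by simpa using h))
        exact circleComplex_injective (mul_left_cancel₀ this h3).symm
      by_cases hs0 : p.2.1 = 0
      · exact Or.inr (Or.inl ⟨hs0, h1.trans hs0, hX (by rw [hs0]; exact zero_ne_one)⟩)
      by_cases hs1 : p.2.1 = 1
      · exact Or.inr (Or.inr ⟨hs1, h1.trans hs1, hY hs0⟩)
      · exact Or.inl (Prod.ext (hX hs1) (Prod.ext h1.symm (hY hs0)))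

/-! ### The octahedron and its boundary -/

theorem hypersimplex_four_two_sum {x : Fin 4 → ℝ} (hx : x ∈ hypersimplex 4 2) :
    x 0 + x 1 + x 2 + x 3 = 2 := by
  have := hx.2
  rw [Fin.sum_univ_four] at this
  exact_mod_cast this

/-- The `ℓ¹`-norm of `(x₀ + x₁ - 1, x₀ + x₂ - 1, x₀ + x₃ - 1)`, for which the octahedron `Δ_{4,2}`
is the unit ball. -/
noncomputable def octNorm (x : Fin 4 → ℝ) : ℝ :=
  |x 0 + x 1 - 1| + |x 0 + x 2 - 1| + |x 0 + x 3 - 1|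

theorem continuous_octNorm : Continuous octNorm := by
  unfold octNorm
  fun_prop

/-- On the plane `∑ xᵢ = 2` the eight sign choices in the `ℓ¹` norm give the eight facet
inequalities; for instance the all-plus sum is `2 x₀ - 1`, which is at most `1` exactly when `x₀ ≤
1`. -/
theorem mem_hypersimplex_iff {x : Fin 4 → ℝ} :
    x ∈ hypersimplex 4 2 ↔ x 0 + x 1 + x 2 + x 3 = 2 ∧ octNorm x ≤ 1 := by
  constructor
  · intro hx
    have hs := hypersimplex_four_two_sum hx
    refine ⟨hs, ?_⟩
    have h0 := hx.1 0
    have h1 := hx.1 1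
    have h2 := hx.1 2
    have h3 := hx.1 3
    unfold octNorm
    rcases abs_cases (x 0 + x 1 - 1) with h | h <;> rcases abs_cases (x 0 + x 2 - 1) with h' | h' <;>
      rcases abs_cases (x 0 + x 3 - 1) with h'' | h'' <;> linarith
  · rintro ⟨hs, hx⟩
    unfold octNorm at hx
    have a1 := abs_le.1 (le_refl |x 0 + x 1 - 1|)
    have a2 := abs_le.1 (le_refl |x 0 + x 2 - 1|)
    have a3 := abs_le.1 (le_refl |x 0 + x 3 - 1|)
    refine ⟨fun i => ?_, by rw [Fin.sum_univ_four, hs]; norm_num⟩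
    fin_cases i <;> constructor <;> simp only [Fin.zero_eta, Fin.mk_one, Fin.reduceFinMk] <;>
      linarith

theorem sum_eq_two_of_mem_affineSpan {x : Fin 4 → ℝ}
    (hx : x ∈ affineSpan ℝ (hypersimplex 4 2)) : x 0 + x 1 + x 2 + x 3 = 2 := by
  refine affineSpan_induction (p := fun x => x 0 + x 1 + x 2 + x 3 = 2) hx
    (fun x hx => hypersimplex_four_two_sum hx) fun c u v w hu hv hw => ?_
  simp only [vsub_eq_sub, vadd_eq_add, Pi.add_apply, Pi.smul_apply, Pi.sub_apply, smul_eq_mul]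
  linear_combination c * hu - c * hv + hw

/-- In the affine span the octahedron is the sublevel set `octNorm ≤ 1`, so its frontier lies in the
level set `1`. Conversely `octNorm` grows linearly along rays from the centre, so a point of level
`1` has points outside the octahedron arbitrarily near. -/
theorem mem_intrinsicFrontier_hypersimplex {x : Fin 4 → ℝ} (hx : x ∈ hypersimplex 4 2) :
    x ∈ intrinsicFrontier ℝ (hypersimplex 4 2) ↔ octNorm x = 1 := by
  set D := hypersimplex 4 2
  set S := affineSpan ℝ D
  have hxS : x ∈ S := subset_affineSpan ℝ D hx
  have hpre : ((↑) ⁻¹' D : Set S) = {y : S | octNorm y ≤ 1} := by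
    ext y
    exact mem_hypersimplex_iff.trans (and_iff_right (sum_eq_two_of_mem_affineSpan y.2))
  have hc : Continuous fun y : S => octNorm y := continuous_octNorm.comp continuous_subtype_val
  have key : (⟨x, hxS⟩ : S) ∈ frontier ((↑) ⁻¹' D : Set S) ↔ octNorm x = 1 := by
    rw [hpre]
    constructor
    · intro h
      exact frontier_le_subset_eq hc continuous_const h
    · intro h
      rw [frontier, (isClosed_le hc continuous_const).closure_eq]
      refine ⟨h.le, fun hint => ?_⟩
      -- The centre of the octahedron, where `octNorm` vanishes.
      let c : Fin 4 → ℝ := fun _ => 1 / 2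
      have hcS : c ∈ S := subset_affineSpan ℝ D (mem_hypersimplex_iff.2
        ⟨by norm_num [c], by norm_num [c, octNorm]⟩)
      let f : ℝ → S := fun r => ⟨AffineMap.lineMap c x r, AffineMap.lineMap_mem r hcS hxS⟩
      have hf : Continuous f := Continuous.subtype_mk AffineMap.lineMap_continuous _
      have hf1 : f 1 = ⟨x, hxS⟩ := Subtype.ext (AffineMap.lineMap_apply_one c x)
      have hN : ∀ r, 0 ≤ r → octNorm (f r) = r := by
        intro r hr
        have e : ∀ i j, (f r : Fin 4 → ℝ) i + (f r : Fin 4 → ℝ) j - 1 = r * (x i + x j - 1) := by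
          intro i j
          simp only [f, c, AffineMap.lineMap_apply_module, Pi.add_apply, Pi.smul_apply, smul_eq_mul]
          ring
        have h' := h
        unfold octNorm at h' ⊢
        rw [e, e, e, abs_mul, abs_mul, abs_mul, abs_of_nonneg hr, ← mul_add, ← mul_add, h', mul_one]
      have hev : ∀ᶠ r in nhds (1 : ℝ), f r ∈ {y : S | octNorm y ≤ 1} := by
        apply hf.continuousAt.eventually
        rw [hf1]
        exact mem_interior_iff_mem_nhds.1 hint
      obtain ⟨ε, hε, hball⟩ := Metric.eventually_nhds_iff.1 hev
      have h2 : octNorm (f (1 + ε / 2)) ≤ 1 := hball (by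
        rw [Real.dist_eq, add_sub_cancel_left, abs_of_pos (half_pos hε)]
        exact half_lt_self hε)
      rw [hN _ (by positivity)] at h2
      linarith
  rw [← key, intrinsicFrontier, Set.mem_image]
  constructor
  · rintro ⟨y, hy, rfl⟩
    exact hy
  · exact fun h => ⟨_, h, rfl⟩

instance compactSpace_hypersimplex (n k : ℕ) : CompactSpace (hypersimplex n k) := by
  rw [← isCompact_iff_compactSpace]
  refine (isCompact_univ_pi fun _ : Fin n => isCompact_Icc (a := (0 : ℝ)) (b := 1)).of_isClosed_subset
    ?_ fun x hx i _ => hx.1 i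
  refine IsClosed.inter (isClosed_unitBox n) (isClosed_eq (by fun_prop) continuous_const)
where
  isClosed_unitBox (n : ℕ) : IsClosed {x : Fin n → ℝ | ∀ i, 0 ≤ x i ∧ x i ≤ 1} := by
    simp only [Set.ofPred_forall]
    exact isClosed_iInter fun i => (isClosed_le continuous_const (continuous_apply i)).inter
      (isClosed_le (continuous_apply i) continuous_const)

/-! ### The projective line as a circle -/

/-- A vector of `ℝ²` as a complex number. -/
def planeComplex (v : Fin 2 → ℝ) : ℂ := ⟨v 0, v 1⟩

theorem planeComplex_smul (c : ℝ) (v : Fin 2 → ℝ) : planeComplex (c • v) = c * planeComplex v := by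
  apply Complex.ext <;> simp [planeComplex]

theorem planeComplex_injective : Function.Injective planeComplex := by
  intro v w h
  ext i
  fin_cases i
  · exact congrArg Complex.re h
  · exact congrArg Complex.im h

theorem planeComplex_ne_zero {v : Fin 2 → ℝ} (hv : v ≠ 0) : planeComplex v ≠ 0 :=
  fun h => hv (planeComplex_injective (h.trans (by apply Complex.ext <;> simp [planeComplex])))

theorem continuous_planeComplex : Continuous planeComplex :=
  Complex.equivRealProdCLM.symm.continuous.comp
    ((continuous_apply (A := fun _ : Fin 2 => ℝ) 0).prodMk (continuous_apply 1))

theorem isQuotientMap_projectivization_mk (m : ℕ) :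
    Topology.IsQuotientMap
      (fun v : {v : Fin m → ℝ // v ≠ 0} => Projectivization.mk ℝ v.1 v.2) := by
  exact ⟨⟨rfl⟩, fun r => ⟨⟨r.rep, r.rep_nonzero⟩, r.mk_rep⟩⟩

/-- The homeomorphism `ℝP¹ → S¹` that doubles angles, as a map to `ℂ`. -/
noncomputable def projLineCircle : ℙ ℝ (Fin 2 → ℝ) → ℂ :=
  Projectivization.lift (fun v => (‖planeComplex v.1‖⁻¹ : ℂ) * angleDouble (planeComplex v.1)) (by
    rintro ⟨_, hv⟩ ⟨w, hw⟩ c rfl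
    have hc : c ≠ 0 := by
      rintro rfl
      exact hv (zero_smul _ _)
    have : ((|c| : ℝ) : ℂ) ≠ 0 := by simpa using hc
    simp only [planeComplex_smul, angleDouble_real_mul, norm_mul, Complex.norm_real,
      Real.norm_eq_abs, Complex.ofReal_mul, mul_inv]
    field_simp)

theorem projLineCircle_mk {v : Fin 2 → ℝ} (hv : v ≠ 0) :
    projLineCircle (Projectivization.mk ℝ v hv) =
      (‖planeComplex v‖⁻¹ : ℂ) * angleDouble (planeComplex v) := rfl

theorem projLineCircle_mk_eq {v : Fin 2 → ℝ} (hv : v ≠ 0) :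
    projLineCircle (Projectivization.mk ℝ v hv) =
      angleDouble ((‖planeComplex v‖⁻¹ : ℝ) * planeComplex v) := by
  rw [projLineCircle_mk, angleDouble_real_mul, abs_of_nonneg (by positivity)]
  push_cast
  rfl

theorem norm_projLineCircle (r : ℙ ℝ (Fin 2 → ℝ)) : ‖projLineCircle r‖ = 1 := by
  induction r using Projectivization.ind with
  | h v hv =>
    have := norm_ne_zero_iff.2 (planeComplex_ne_zero hv)
    rw [projLineCircle_mk, norm_mul, norm_inv, Complex.norm_real, norm_norm, norm_angleDouble,
      inv_mul_cancel₀ this]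

/-- Unit representatives with the same doubled angle agree up to sign, hence span the same line. -/
theorem projLineCircle_injective : Function.Injective projLineCircle := by
  intro r r'
  induction r using Projectivization.ind with | h v hv => ?_
  induction r' using Projectivization.ind with | h w hw => ?_
  intro h
  have h1 := inv_ne_zero (norm_ne_zero_iff.2 (planeComplex_ne_zero hv))
  have h2 := inv_ne_zero (norm_ne_zero_iff.2 (planeComplex_ne_zero hw))
  have h3 := norm_ne_zero_iff.2 (planeComplex_ne_zero hv)
  rw [projLineCircle_mk_eq, projLineCircle_mk_eq, angleDouble_eq_iff, ← planeComplex_smul,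
    ← planeComplex_smul] at h
  rw [Projectivization.mk_eq_mk_iff']
  rcases h with h | h
  · refine ⟨‖planeComplex v‖ * ‖planeComplex w‖⁻¹, ?_⟩
    rw [mul_smul, ← planeComplex_injective h, smul_smul, mul_inv_cancel₀ h3, one_smul]
  · refine ⟨-(‖planeComplex v‖ * ‖planeComplex w‖⁻¹), ?_⟩
    have h' : planeComplex (‖planeComplex v‖⁻¹ • v) = planeComplex ((-1 : ℝ) • ‖planeComplex w‖⁻¹ • w) := by
      rw [h, planeComplex_smul (-1)]
      simp
    have h'' := planeComplex_injective h'
    rw [neg_smul, one_smul] at h''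
    rw [neg_smul, mul_smul, ← smul_neg, ← h'', smul_smul, mul_inv_cancel₀ h3, one_smul]

theorem exists_projLineCircle_eq {w : ℂ} (hw : ‖w‖ = 1) : ∃ r, projLineCircle r = w := by
  obtain ⟨z, rfl⟩ := angleDouble_surjective w
  rw [norm_angleDouble] at hw
  have hz : (![z.re, z.im] : Fin 2 → ℝ) ≠ 0 := by
    intro h
    have : z = 0 := Complex.ext (congrFun h 0) (congrFun h 1)
    simp [this] at hw
  refine ⟨Projectivization.mk ℝ _ hz, ?_⟩
  have : planeComplex ![z.re, z.im] = z := Complex.ext rfl rfl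
  rw [projLineCircle_mk, this, hw]
  simp

theorem continuous_projLineCircle : Continuous projLineCircle := by
  rw [(isQuotientMap_projectivization_mk 2).continuous_iff]
  have h : Continuous fun v : {v : Fin 2 → ℝ // v ≠ 0} => planeComplex v.1 :=
    continuous_planeComplex.comp continuous_subtype_val
  have h2 : ∀ v : {v : Fin 2 → ℝ // v ≠ 0}, (‖planeComplex v.1‖ : ℂ) ≠ 0 := fun v => by
    simpa using planeComplex_ne_zero v.2
  exact ((Complex.continuous_ofReal.comp h.norm).inv₀ h2).mul (continuous_angleDouble.comp h)

instance compactSpace_projectivization (m : ℕ) : CompactSpace (ℙ ℝ (Fin m → ℝ)) := by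
  let f : Metric.sphere (0 : Fin m → ℝ) 1 → ℙ ℝ (Fin m → ℝ) := fun v =>
    Projectivization.mk ℝ v.1 (ne_zero_of_mem_unit_sphere v)
  have hf : Continuous f := (isQuotientMap_projectivization_mk m).continuous.comp
    (Continuous.subtype_mk continuous_subtype_val fun v => ne_zero_of_mem_unit_sphere v)
  have hs : Function.Surjective f := by
    intro r
    induction r using Projectivization.ind with | h v hv => ?_
    have hv' := norm_ne_zero_iff.2 hv
    refine ⟨⟨‖v‖⁻¹ • v, by simp [norm_smul, hv']⟩, ?_⟩
    exact (Projectivization.mk_eq_mk_iff' ..).2 ⟨‖v‖⁻¹, rfl⟩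
  exact hs.compactSpace hf

/-! ### The collapsed product over the octahedron -/

/-- The map from `Δ_{4,2} × ℝP¹` to `ℝ³ × ℂ` that collapses `ℝP¹` over the boundary. -/
noncomputable def octVec (p : hypersimplex 4 2 × ℙ ℝ (Fin 2 → ℝ)) : EuclideanSpace ℝ (Fin 5) :=
  realComplexVec (p.1.1 0 + p.1.1 1 - 1) (p.1.1 0 + p.1.1 2 - 1) (p.1.1 0 + p.1.1 3 - 1)
    ((1 - octNorm p.1.1 : ℝ) * projLineCircle p.2)

theorem continuous_octVec : Continuous octVec := by
  have h := continuous_projLineCircle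
  have h' := continuous_octNorm
  have hx : ∀ i, Continuous fun p : hypersimplex 4 2 × ℙ ℝ (Fin 2 → ℝ) => p.1.1 i := fun i =>
    (continuous_apply i).comp (continuous_subtype_val.comp continuous_fst)
  unfold octVec
  apply Continuous.realComplexVec <;> fun_prop

/-- The `ℓ¹` norm of the real part of `octVec` and the modulus of its complex part add up to `1`, so
`k = 1`. The circle coordinate is then recovered unless its radius `1 - octNorm x` vanishes. -/
theorem octVec_eq_smul {p q : hypersimplex 4 2 × ℙ ℝ (Fin 2 → ℝ)} {k : ℝ} (hk : 0 < k)
    (h : octVec q = k • octVec p) :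
    p.1 = q.1 ∧ (octNorm p.1.1 = 1 ∨ p.2 = q.2) := by
  obtain ⟨⟨x, hx⟩, r⟩ := p
  obtain ⟨⟨y, hy⟩, r'⟩ := q
  rw [octVec, octVec, smul_realComplexVec, realComplexVec_inj] at h
  obtain ⟨h0, h1, h2, h3⟩ := h
  simp only at h0 h1 h2 h3 ⊢
  obtain ⟨hxs, hxn⟩ := mem_hypersimplex_iff.1 hx
  obtain ⟨hys, hyn⟩ := mem_hypersimplex_iff.1 hy
  have e1 : octNorm y = k * octNorm x := by
    rw [octNorm, octNorm, h0, h1, h2, abs_mul, abs_mul, abs_mul, abs_of_pos hk]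
    ring
  have e2 : 1 - octNorm y = k * (1 - octNorm x) := by
    have := congrArg norm h3
    simp only [norm_mul, norm_projLineCircle, Complex.norm_real, Real.norm_eq_abs, mul_one,
      abs_of_nonneg (sub_nonneg.2 hxn), abs_of_nonneg (sub_nonneg.2 hyn), abs_of_pos hk] at this
    exact this
  have hk1 : k = 1 := by linarith
  subst hk1
  have e : x = y := by
    ext i
    fin_cases i <;> simp only [Fin.zero_eta, Fin.mk_one, Fin.reduceFinMk] <;> linarith
  subst e
  refine ⟨rfl, or_iff_not_imp_left.2 fun hne => ?_⟩
  have : ((1 - octNorm x : ℝ) : ℂ) ≠ 0 := by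
    exact_mod_cast sub_ne_zero.2 (Ne.symm hne)
  rw [Complex.ofReal_one, one_mul] at h3
  exact projLineCircle_injective (mul_left_cancel₀ this h3).symm

theorem nonempty_hypersimplex_quotient_homeomorph :
    Nonempty (Quotient (boundarySetoid (hypersimplex 4 2) (ℙ ℝ (Fin 2 → ℝ))) ≃ₜ unitSphere 4) := by
  refine nonempty_homeomorph_unitSphere (π := Quotient.mk _) isQuotientMap_quotient_mk'
    continuous_octVec ?_ ?_ ?_
  · rintro ⟨⟨x, hx⟩, r⟩ h
    rw [octVec, ← realComplexVec_zero, realComplexVec_inj] at h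
    obtain ⟨h0, h1, h2, h3⟩ := h
    simp only at h0 h1 h2 h3
    have hn : octNorm x = 0 := by simp [octNorm, h0, h1, h2]
    have := congrArg norm h3
    simp [norm_projLineCircle, hn] at this
  · intro y hy
    obtain ⟨a, b, c, w, rfl⟩ := exists_eq_realComplexVec y
    obtain ⟨r, hr⟩ : ∃ r, (‖w‖ : ℂ) * projLineCircle r = w := by
      rcases eq_or_ne w 0 with hw | hw
      · obtain ⟨r, -⟩ := exists_projLineCircle_eq (w := 1) (by simp)
        exact ⟨r, by simp [hw]⟩
      · have h3 : (‖w‖ : ℂ) ≠ 0 := by simpa using hw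
        obtain ⟨r, hr⟩ := exists_projLineCircle_eq (w := w / ‖w‖) (by
          rw [norm_div, Complex.norm_real, norm_norm, div_self (norm_ne_zero_iff.2 hw)])
        exact ⟨r, by rw [hr]; field_simp⟩
    have ha := abs_nonneg a
    have hb := abs_nonneg b
    have hc := abs_nonneg c
    have hw := norm_nonneg w
    -- `G` is the norm whose unit sphere is the image of `octVec`.
    obtain ⟨G, hGe⟩ : ∃ G, G = |a| + |b| + |c| + ‖w‖ := ⟨_, rfl⟩
    have hG : 0 < G := by
      refine lt_of_le_of_ne (by linarith) fun h => hy ?_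
      rw [abs_eq_zero.1 (by linarith : |a| = 0), abs_eq_zero.1 (by linarith : |b| = 0),
        abs_eq_zero.1 (by linarith : |c| = 0), norm_eq_zero.1 (by linarith : ‖w‖ = 0)]
      exact realComplexVec_zero
    -- The solution of `x₀ + x₁ - 1 = a/G`, `x₀ + x₂ - 1 = b/G`, `x₀ + x₃ - 1 = c/G` with `∑ xᵢ =
    -- 2`.
    let x : Fin 4 → ℝ := ![(1 + G⁻¹ * a + G⁻¹ * b + G⁻¹ * c) / 2,
      (1 + G⁻¹ * a - G⁻¹ * b - G⁻¹ * c) / 2, (1 - G⁻¹ * a + G⁻¹ * b - G⁻¹ * c) / 2,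
      (1 - G⁻¹ * a - G⁻¹ * b + G⁻¹ * c) / 2]
    have x0 : x 0 = (1 + G⁻¹ * a + G⁻¹ * b + G⁻¹ * c) / 2 := rfl
    have x1 : x 1 = (1 + G⁻¹ * a - G⁻¹ * b - G⁻¹ * c) / 2 := rfl
    have x2 : x 2 = (1 - G⁻¹ * a + G⁻¹ * b - G⁻¹ * c) / 2 := rfl
    have x3 : x 3 = (1 - G⁻¹ * a - G⁻¹ * b + G⁻¹ * c) / 2 := rfl
    have e0 : x 0 + x 1 - 1 = G⁻¹ * a := by rw [x0, x1]; ring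
    have e1 : x 0 + x 2 - 1 = G⁻¹ * b := by rw [x0, x2]; ring
    have e2 : x 0 + x 3 - 1 = G⁻¹ * c := by rw [x0, x3]; ring
    have hn : octNorm x = 1 - G⁻¹ * ‖w‖ := by
      rw [octNorm, e0, e1, e2, abs_mul, abs_mul, abs_mul, abs_of_pos (inv_pos.2 hG)]
      have : G⁻¹ * G = 1 := inv_mul_cancel₀ hG.ne'
      rw [hGe] at this ⊢
      linear_combination this
    have hx : x ∈ hypersimplex 4 2 := mem_hypersimplex_iff.2
      ⟨by rw [x0, x1, x2, x3]; ring, by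
        rw [hn]
        have := mul_nonneg (inv_pos.2 hG).le hw
        linarith⟩
    refine ⟨(⟨x, hx⟩, r), G⁻¹, inv_pos.2 hG, ?_⟩
    rw [octVec, smul_realComplexVec, realComplexVec_inj]
    refine ⟨e0, e1, e2, ?_⟩
    simp only
    rw [hn, sub_sub_cancel, Complex.ofReal_mul, mul_assoc, hr]
  · rintro p q
    rw [Quotient.eq]
    constructor
    · rintro (rfl | ⟨h1, h2⟩)
      · exact ⟨1, one_pos, (one_smul _ _).symm⟩
      · refine ⟨1, one_pos, ?_⟩
        rw [mem_intrinsicFrontier_hypersimplex p.1.2] at h2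
        rw [one_smul, octVec, octVec, ← h1, h2]
        simp
    · rintro ⟨k, hk, h⟩
      obtain ⟨h1, h2 | h2⟩ := octVec_eq_smul hk h
      · exact Or.inr ⟨h1, (mem_intrinsicFrontier_hypersimplex p.1.2).2 h2⟩
      · exact Or.inl (Prod.ext h1 h2)

/-! ### Plücker coordinates of planes -/

namespace RealGrassmannian

/-- The `2 × 2` minors (Plücker coordinates) of a pair of vectors. -/
def minor {n : ℕ} (v : Fin 2 → Fin n → ℝ) (i j : Fin n) : ℝ :=
  v 0 i * v 1 j - v 0 j * v 1 i

theorem minor_swap {n : ℕ} (v : Fin 2 → Fin n → ℝ) (i j : Fin n) : minor v j i = -minor v i j := by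
  unfold minor
  ring

theorem minor_self {n : ℕ} (v : Fin 2 → Fin n → ℝ) (i : Fin n) : minor v i i = 0 := by
  unfold minor
  ring

theorem minor_plucker {n : ℕ} (v : Fin 2 → Fin n → ℝ) (i j k l : Fin n) :
    minor v i j * minor v k l - minor v i k * minor v j l + minor v i l * minor v j k = 0 := by
  unfold minor
  ring

/-- Expansion of the `3 × 3` determinant with rows `v m`, `v 0`, `v 1`, which has a repeated row. It
expresses the vectors of a frame through the columns of the matrix of minors. -/
theorem minor_mul_apply {n : ℕ} (v : Fin 2 → Fin n → ℝ) (i j l : Fin n) (m : Fin 2) :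
    minor v i j * v m l = v m i * minor v l j - v m j * minor v l i := by
  unfold minor
  fin_cases m <;> simp only [Fin.zero_eta, Fin.mk_one] <;> ring

theorem linearIndependent_iff_exists_minor_ne_zero {n : ℕ} {v : Fin 2 → Fin n → ℝ} :
    LinearIndependent ℝ v ↔ ∃ i j, minor v i j ≠ 0 := by
  rw [Fintype.linearIndependent_iff]
  constructor
  · intro h
    by_contra! h0
    have h1 : ∀ m j, v m j = 0 := by
      intro m j
      -- The entries of `v₁ⱼ v₀ - v₀ⱼ v₁` are minors, so this is a linear relation and its
      -- coefficients vanish.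
      have := h ![v 1 j, -v 0 j] (by
        ext i
        have := h0 i j
        unfold minor at this
        simp only [Fin.sum_univ_two, Matrix.cons_val_zero, Matrix.cons_val_one, Pi.add_apply,
          Pi.smul_apply, smul_eq_mul, Pi.zero_apply]
        linear_combination this)
      fin_cases m
      · simpa using this 1
      · simpa using this 0
    have := h (fun _ => 1) (by
      ext i
      simp [h1]) 0
    exact one_ne_zero this
  · rintro ⟨i, j, hij⟩ g hg
    have hi := congrFun hg i
    have hj := congrFun hg j
    simp only [Fin.sum_univ_two, Pi.add_apply, Pi.smul_apply, smul_eq_mul, Pi.zero_apply] at hi hj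
    unfold minor at hij
    have h0 : g 0 = 0 := (mul_eq_zero.1 (show g 0 * (v 0 i * v 1 j - v 0 j * v 1 i) = 0 by
      linear_combination v 1 j * hi - v 1 i * hj)).resolve_right hij
    have h1 : g 1 = 0 := (mul_eq_zero.1 (show g 1 * (v 0 i * v 1 j - v 0 j * v 1 i) = 0 by
      linear_combination v 0 i * hj - v 0 j * hi)).resolve_right hij
    intro m
    fin_cases m
    · exact h0
    · exact h1

/-- Columns of the matrix of minors of `w` are, up to `k`, combinations of `v 0` and `v 1`; a
nonzero minor recovers each `w m` from two of these columns. -/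
theorem span_le_span_of_minor {n : ℕ} {v w : Fin 2 → Fin n → ℝ} (hw : LinearIndependent ℝ w)
    {k : ℝ} (h : ∀ i j, minor w i j = k * minor v i j) :
    Submodule.span ℝ (Set.range w) ≤ Submodule.span ℝ (Set.range v) := by
  obtain ⟨i, j, hij⟩ := linearIndependent_iff_exists_minor_ne_zero.1 hw
  rw [Submodule.span_le]
  rintro _ ⟨m, rfl⟩
  have hm : ∀ j, (fun l => minor w l j) ∈ Submodule.span ℝ (Set.range v) := by
    intro j
    have : (fun l => minor w l j) = (k * v 1 j) • v 0 - (k * v 0 j) • v 1 := by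
      ext l
      rw [h]
      simp only [minor, Pi.sub_apply, Pi.smul_apply, smul_eq_mul]
      ring
    rw [this]
    exact Submodule.sub_mem _ (Submodule.smul_mem _ _ (Submodule.subset_span ⟨0, rfl⟩))
      (Submodule.smul_mem _ _ (Submodule.subset_span ⟨1, rfl⟩))
  have : w m = (minor w i j)⁻¹ •
      (w m i • (fun l => minor w l j) - w m j • (fun l => minor w l i)) := by
    ext l
    simp only [Pi.sub_apply, Pi.smul_apply, smul_eq_mul]
    rw [← minor_mul_apply, inv_mul_cancel_left₀ hij]
  rw [this]
  exact Submodule.smul_mem _ _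
    (Submodule.sub_mem _ (Submodule.smul_mem _ _ (hm j)) (Submodule.smul_mem _ _ (hm i)))

theorem ofFrame_eq_iff {n : ℕ} {v w : Frame n 2} :
    ofFrame v = ofFrame w ↔ ∃ k : ℝ, k ≠ 0 ∧ ∀ i j, minor w.1 i j = k * minor v.1 i j := by
  constructor
  · intro h
    have h' : Submodule.span ℝ (Set.range v.1) = Submodule.span ℝ (Set.range w.1) :=
      congrArg Subtype.val h
    have hm : ∀ m, ∃ a b : ℝ, a • v.1 0 + b • v.1 1 = w.1 m := by
      intro m
      rw [← Submodule.mem_span_pair]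
      have hr : Set.range v.1 = {v.1 0, v.1 1} := by
        ext x
        simp [Fin.exists_fin_two, eq_comm]
      rw [← hr, h']
      exact Submodule.subset_span ⟨m, rfl⟩
    choose a b hab using hm
    -- The factor is the determinant of the change of basis.
    have hk : ∀ i j, minor w.1 i j = (a 0 * b 1 - a 1 * b 0) * minor v.1 i j := by
      intro i j
      rw [minor, ← hab, ← hab]
      simp only [minor, Pi.add_apply, Pi.smul_apply, smul_eq_mul]
      ring
    refine ⟨_, fun h0 => ?_, hk⟩
    obtain ⟨i, j, hij⟩ := linearIndependent_iff_exists_minor_ne_zero.1 w.2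
    exact hij (by rw [hk, h0, zero_mul])
  · rintro ⟨k, hk, h⟩
    refine Subtype.ext (le_antisymm (span_le_span_of_minor v.2 (k := k⁻¹) fun i j => ?_)
      (span_le_span_of_minor w.2 h))
    rw [h, inv_mul_cancel_left₀ hk]

theorem minor_signMap {n : ℕ} (t : Fin n → ℤˣ) (v : Fin 2 → Fin n → ℝ) (i j : Fin n) :
    minor (fun m => signMap t (v m)) i j = ((t i * t j : ℤˣ) : ℤ) * minor v i j := by
  simp only [minor, signMap, LinearMap.coe_mk, AddHom.coe_mk]
  push_cast
  ring

/-- The action of sign vectors on frames. -/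
noncomputable def signFrame {n k : ℕ} (t : Fin n → ℤˣ) (v : Frame n k) : Frame n k :=
  ⟨fun m => signMap t (v.1 m), v.2.map' _ (LinearMap.ker_eq_bot.2 (signMap_injective t))⟩

theorem ofFrame_signFrame {n k : ℕ} (t : Fin n → ℤˣ) (v : Frame n k) :
    ofFrame (signFrame t v) = t • ofFrame v := by
  apply Subtype.ext
  change Submodule.span ℝ (Set.range (signMap t ∘ v.1)) =
    (Submodule.span ℝ (Set.range v.1)).map (signMap t)
  rw [Submodule.map_span, Set.range_comp]

/-- The projection from frames to the orbit space of the sign action. -/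
noncomputable def frameOrbit {n k : ℕ} (v : Frame n k) : SignOrbitSpace n k :=
  Quotient.mk _ (ofFrame v)

theorem isQuotientMap_frameOrbit (n k : ℕ) :
    Topology.IsQuotientMap (frameOrbit : Frame n k → SignOrbitSpace n k) :=
  Topology.IsQuotientMap.comp (g := Quotient.mk _) isQuotientMap_quotient_mk'
    ⟨⟨rfl⟩, ofFrame_surjective⟩

theorem frameOrbit_eq_iff {n : ℕ} {v w : Frame n 2} :
    frameOrbit v = frameOrbit w ↔ ∃ (t : Fin n → ℤˣ) (k : ℝ), k ≠ 0 ∧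
      ∀ i j, minor w.1 i j = k * (((t i * t j : ℤˣ) : ℤ) * minor v.1 i j) := by
  rw [eq_comm, frameOrbit, frameOrbit, Quotient.eq]
  change ofFrame w ∈ MulAction.orbit _ (ofFrame v) ↔ _
  rw [MulAction.mem_orbit_iff]
  refine exists_congr fun t => ?_
  rw [← ofFrame_signFrame, ofFrame_eq_iff]
  refine exists_congr fun k => and_congr_right fun _ => forall₂_congr fun i j => ?_
  rw [← minor_signMap]
  rfl

/-! ### Compactness of the orbit space -/

theorem isCompact_orthonormal_pairs (n : ℕ) :
    IsCompact {v : Fin 2 → Fin n → ℝ | (∀ m, ∑ i, v m i ^ 2 = 1) ∧ ∑ i, v 0 i * v 1 i = 0} := by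
  refine (isCompact_univ_pi fun _ : Fin 2 => isCompact_univ_pi fun _ : Fin n =>
    isCompact_Icc (a := (-1 : ℝ)) (b := 1)).of_isClosed_subset ?_ ?_
  · rw [Set.ofPred_and, Set.ofPred_forall]
    exact (isClosed_iInter fun m => isClosed_eq (by fun_prop) continuous_const).inter
      (isClosed_eq (by fun_prop) continuous_const)
  · intro v hv m _ i _
    rw [Set.mem_Icc, ← abs_le, ← sq_le_one_iff_abs_le_one, ← hv.1 m]
    exact Finset.single_le_sum (fun j _ => sq_nonneg (v m j)) (Finset.mem_univ i)

/-- If all minors vanished, then `v₁ⱼ = ∑ᵢ v₀ᵢ² v₁ⱼ = v₀ⱼ ∑ᵢ v₀ᵢ v₁ᵢ = 0` for every `j`. -/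
theorem linearIndependent_of_orthonormal {n : ℕ} {v : Fin 2 → Fin n → ℝ}
    (hv : (∀ m, ∑ i, v m i ^ 2 = 1) ∧ ∑ i, v 0 i * v 1 i = 0) : LinearIndependent ℝ v := by
  rw [linearIndependent_iff_exists_minor_ne_zero]
  by_contra! h
  have h1 : ∀ j, v 1 j = 0 := by
    intro j
    calc v 1 j = ∑ i, v 0 i ^ 2 * v 1 j := by rw [← Finset.sum_mul, hv.1 0, one_mul]
      _ = ∑ i, v 0 j * (v 0 i * v 1 i) := Finset.sum_congr rfl fun i _ => by
        have := h i j
        unfold minor at this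
        linear_combination v 0 i * this
      _ = 0 := by rw [← Finset.mul_sum, hv.2, mul_zero]
  have := hv.1 1
  simp [h1] at this

theorem sum_sq_pos {n : ℕ} {x : Fin n → ℝ} (hx : x ≠ 0) : 0 < ∑ i, x i ^ 2 := by
  obtain ⟨i, hi⟩ := Function.ne_iff.1 hx
  exact Finset.sum_pos' (fun j _ => sq_nonneg _) ⟨i, Finset.mem_univ i, pow_two_pos_of_ne_zero hi⟩

theorem exists_unit_smul {n : ℕ} {x : Fin n → ℝ} (hx : x ≠ 0) :
    ∃ a : ℝ, a ≠ 0 ∧ ∑ i, (a * x i) ^ 2 = 1 := by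
  have h := sum_sq_pos hx
  refine ⟨(√(∑ i, x i ^ 2))⁻¹, inv_ne_zero (Real.sqrt_pos.2 h).ne', ?_⟩
  simp only [mul_pow]
  rw [← Finset.mul_sum, inv_pow, Real.sq_sqrt h.le, inv_mul_cancel₀ h.ne']

/-- Gram–Schmidt: `a` and `b` normalise, `c` is the projection coefficient, and all minors are
multiplied by `a * b`, so the plane is unchanged. -/
theorem exists_orthonormal_frame {n : ℕ} (v : Frame n 2) :
    ∃ w : Frame n 2, ((∀ m, ∑ i, w.1 m i ^ 2 = 1) ∧ ∑ i, w.1 0 i * w.1 1 i = 0) ∧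
      ofFrame v = ofFrame w := by
  obtain ⟨i, j, hij⟩ := linearIndependent_iff_exists_minor_ne_zero.1 v.2
  have hv0 : v.1 0 ≠ 0 := fun h => hij (by simp [minor, h])
  obtain ⟨a, ha, ha1⟩ := exists_unit_smul hv0
  set c := ∑ i, a * v.1 0 i * v.1 1 i with hc
  have hf : (fun i => v.1 1 i - c * (a * v.1 0 i)) ≠ 0 := by
    intro h
    have h' : ∀ i, v.1 1 i = c * (a * v.1 0 i) := fun i => sub_eq_zero.1 (congrFun h i)
    exact hij (by rw [minor, h', h']; ring)
  obtain ⟨b, hb, hb1⟩ := exists_unit_smul hf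
  have ho : (∀ m, ∑ i, (![fun i => a * v.1 0 i, fun i => b * (v.1 1 i - c * (a * v.1 0 i))] :
      Fin 2 → Fin n → ℝ) m i ^ 2 = 1) ∧ ∑ i, (![fun i => a * v.1 0 i,
      fun i => b * (v.1 1 i - c * (a * v.1 0 i))] : Fin 2 → Fin n → ℝ) 0 i * (![fun i => a * v.1 0 i,
      fun i => b * (v.1 1 i - c * (a * v.1 0 i))] : Fin 2 → Fin n → ℝ) 1 i = 0 := by
    refine ⟨fun m => ?_, ?_⟩
    · fin_cases m
      · exact ha1
      · exact hb1
    · calc _ = ∑ i, (b * (a * v.1 0 i * v.1 1 i) - b * c * (a * v.1 0 i) ^ 2) :=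
            Finset.sum_congr rfl fun i _ => by
              simp only [Matrix.cons_val_zero, Matrix.cons_val_one]
              ring
        _ = 0 := by
            rw [Finset.sum_sub_distrib, ← Finset.mul_sum, ← Finset.mul_sum, ha1, ← hc]
            ring
  refine ⟨⟨_, linearIndependent_of_orthonormal ho⟩, ho, ?_⟩
  rw [ofFrame_eq_iff]
  refine ⟨a * b, mul_ne_zero ha hb, fun i j => ?_⟩
  simp only [minor, Matrix.cons_val_zero, Matrix.cons_val_one]
  ring

instance compactSpace_signOrbitSpace (n : ℕ) : CompactSpace (SignOrbitSpace n 2) := by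
  have hK := isCompact_iff_compactSpace.1 (isCompact_orthonormal_pairs n)
  let f : {v : Fin 2 → Fin n → ℝ | (∀ m, ∑ i, v m i ^ 2 = 1) ∧ ∑ i, v 0 i * v 1 i = 0} →
      SignOrbitSpace n 2 := fun v => frameOrbit ⟨v.1, linearIndependent_of_orthonormal v.2⟩
  have hf : Continuous f := (isQuotientMap_frameOrbit n 2).continuous.comp
    (Continuous.subtype_mk continuous_subtype_val _)
  have hs : Function.Surjective f := by
    intro x
    obtain ⟨v, rfl⟩ := (isQuotientMap_frameOrbit n 2).surjective x
    obtain ⟨w, hw, h⟩ := exists_orthonormal_frame v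
    exact ⟨⟨w.1, hw⟩, by rw [frameOrbit, h]; rfl⟩
  exact hs.compactSpace hf

end RealGrassmannian

/-! ### The sign orbits as rays of `ℝ³ × ℂ` -/

namespace RealGrassmannian

/-- By the Plücker relation the skew matrix `(pᵢⱼ)` has rank two: if `pᵢⱼ ≠ 0`, the minors of its
rows `i` and `j` are `pᵢⱼ` times the given coordinates. -/
theorem exists_minors_eq {p01 p02 p03 p12 p13 p23 : ℝ}
    (hP : p01 * p23 - p02 * p13 + p03 * p12 = 0)
    (hne : p01 ≠ 0 ∨ p02 ≠ 0 ∨ p03 ≠ 0 ∨ p12 ≠ 0 ∨ p13 ≠ 0 ∨ p23 ≠ 0) :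
    ∃ (v : Fin 2 → Fin 4 → ℝ) (k : ℝ), k ≠ 0 ∧ minor v 0 1 = k * p01 ∧ minor v 0 2 = k * p02 ∧
      minor v 0 3 = k * p03 ∧ minor v 1 2 = k * p12 ∧ minor v 1 3 = k * p13 ∧
      minor v 2 3 = k * p23 := by
  let r0 : Fin 4 → ℝ := ![0, p01, p02, p03]
  let r1 : Fin 4 → ℝ := ![-p01, 0, p12, p13]
  let r2 : Fin 4 → ℝ := ![-p02, -p12, 0, p23]
  let r3 : Fin 4 → ℝ := ![-p03, -p13, -p23, 0]
  rcases hne with h | h | h | h | h | h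
  · refine ⟨![r0, r1], p01, h, ?_, ?_, ?_, ?_, ?_, ?_⟩ <;>
      simp [minor, r0, r1, -mul_eq_mul_left_iff, -mul_eq_mul_right_iff] <;>
      first | done | linear_combination hP | linear_combination -hP | ring
  · refine ⟨![r0, r2], p02, h, ?_, ?_, ?_, ?_, ?_, ?_⟩ <;>
      simp [minor, r0, r2, -mul_eq_mul_left_iff, -mul_eq_mul_right_iff] <;>
      first | done | linear_combination hP | linear_combination -hP | ring
  · refine ⟨![r0, r3], p03, h, ?_, ?_, ?_, ?_, ?_, ?_⟩ <;>
      simp [minor, r0, r3, -mul_eq_mul_left_iff, -mul_eq_mul_right_iff] <;>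
      first | done | linear_combination hP | linear_combination -hP | ring
  · refine ⟨![r1, r2], p12, h, ?_, ?_, ?_, ?_, ?_, ?_⟩ <;>
      simp [minor, r1, r2, -mul_eq_mul_left_iff, -mul_eq_mul_right_iff] <;>
      first | done | linear_combination hP | linear_combination -hP | ring
  · refine ⟨![r1, r3], p13, h, ?_, ?_, ?_, ?_, ?_, ?_⟩ <;>
      simp [minor, r1, r3, -mul_eq_mul_left_iff, -mul_eq_mul_right_iff] <;>
      first | done | linear_combination hP | linear_combination -hP | ring
  · refine ⟨![r2, r3], p23, h, ?_, ?_, ?_, ?_, ?_, ?_⟩ <;>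
      simp [minor, r2, r3, -mul_eq_mul_left_iff, -mul_eq_mul_right_iff] <;>
      first | done | linear_combination hP | linear_combination -hP | ring

/-- `p + iq` is a complex square root of `u + 2ia`. -/
theorem exists_sq_sub_sq_eq (u a : ℝ) : ∃ p q : ℝ, p ^ 2 - q ^ 2 = u ∧ p * q = a := by
  obtain ⟨z, hz⟩ := IsAlgClosed.exists_pow_nat_eq (⟨u, 2 * a⟩ : ℂ) (n := 2) two_pos
  have h0 := congrArg Complex.re hz
  have h1 := congrArg Complex.im hz
  simp only [sq, Complex.mul_re, Complex.mul_im] at h0 h1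
  exact ⟨z.re, z.im, by linarith, by linarith⟩

/-- The identity `(x² + y²)² = (x² - y²)² + 4 (xy)²` determines the sum of the squares from their
difference and the product. -/
theorem sq_eq_of_sq_sub_sq_eq {x y a b : ℝ} (h : x ^ 2 - y ^ 2 = a ^ 2 - b ^ 2)
    (h' : (x * y) ^ 2 = (a * b) ^ 2) : x ^ 2 = a ^ 2 ∧ y ^ 2 = b ^ 2 := by
  have : (x ^ 2 + y ^ 2) ^ 2 = (a ^ 2 + b ^ 2) ^ 2 := by
    linear_combination (x ^ 2 - y ^ 2 + (a ^ 2 - b ^ 2)) * h + 4 * h'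
  have := (pow_left_inj₀ (by positivity) (by positivity) two_ne_zero).1 this
  constructor <;> linarith

theorem exists_sign_of_sq_eq {x a : ℝ} (h : x ^ 2 = a ^ 2) : ∃ σ : ℤˣ, x = (σ : ℤ) * a := by
  rcases sq_eq_sq_iff_eq_or_eq_neg.1 h with rfl | rfl
  · exact ⟨1, by simp⟩
  · exact ⟨-1, by simp⟩

theorem sign_mul_self (σ : ℤˣ) : ((σ : ℤ) : ℝ) * ((σ : ℤ) : ℝ) = 1 := by
  rcases Int.units_eq_one_or σ with rfl | rfl <;> simp

theorem exists_signs_of_mul_eq {x y a b : ℝ} {ε : ℤˣ} (hx : x ^ 2 = a ^ 2) (hy : y ^ 2 = b ^ 2)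
    (h : x * y = (ε : ℤ) * (a * b)) :
    ∃ σ : ℤˣ, x = (σ : ℤ) * a ∧ y = ((ε * σ : ℤˣ) : ℤ) * b := by
  have hε := sign_mul_self ε
  -- If `a = 0` the sign of `x` is free and is chosen to fit `y`; otherwise the sign of `x` forces
  -- that of `y`.
  rcases eq_or_ne a 0 with rfl | ha
  · obtain ⟨τ, hτ⟩ := exists_sign_of_sq_eq hy
    refine ⟨ε * τ, by simpa using hx, ?_⟩
    rw [hτ]
    push_cast
    linear_combination (-(τ : ℤ) * b) * hε
  · obtain ⟨σ, hσ⟩ := exists_sign_of_sq_eq hx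
    have hσ1 := sign_mul_self σ
    refine ⟨σ, hσ, mul_left_cancel₀ ha ?_⟩
    rw [hσ] at h
    push_cast
    linear_combination (σ : ℤ) * h - a * y * hσ1

theorem forall_minor_eq {v w : Fin 2 → Fin 4 → ℝ} {c : Fin 4 → Fin 4 → ℝ}
    (hc : ∀ i j, c i j = c j i)
    (h : ∀ i j, i < j → minor w i j = c i j * minor v i j) (i j : Fin 4) :
    minor w i j = c i j * minor v i j := by
  rcases lt_trichotomy i j with hij | rfl | hij
  · exact h i j hij
  · rw [minor_self, minor_self, mul_zero]
  · rw [minor_swap w, minor_swap v, h j i hij, hc]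
    ring

theorem exists_minor_ne_zero (v : Frame 4 2) : minor v.1 0 1 ≠ 0 ∨ minor v.1 0 2 ≠ 0 ∨
    minor v.1 0 3 ≠ 0 ∨ minor v.1 1 2 ≠ 0 ∨ minor v.1 1 3 ≠ 0 ∨ minor v.1 2 3 ≠ 0 := by
  by_contra! h
  obtain ⟨h01, h02, h03, h12, h13, h23⟩ := h
  obtain ⟨i, j, hij⟩ := linearIndependent_iff_exists_minor_ne_zero.1 v.2
  refine hij ?_
  rw [forall_minor_eq (v := v.1) (c := fun _ _ => 0) (fun _ _ => rfl), zero_mul]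
  intro i j h
  rw [zero_mul]
  fin_cases i <;> fin_cases j <;> first | exact absurd h (by decide) | assumption

/-- If two pairs of vectors have the same squares of minors and proportional products of
complementary minors, then they differ by signs. -/
theorem exists_signs_of_minors {P : Fin 4 → Fin 4 → ℝ} {w : Fin 2 → Fin 4 → ℝ} {ε : ℤˣ}
    (h01 : minor w 0 1 ^ 2 = P 0 1 ^ 2) (h23 : minor w 2 3 ^ 2 = P 2 3 ^ 2)
    (h02 : minor w 0 2 ^ 2 = P 0 2 ^ 2) (h13 : minor w 1 3 ^ 2 = P 1 3 ^ 2)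
    (h03 : minor w 0 3 ^ 2 = P 0 3 ^ 2) (h12 : minor w 1 2 ^ 2 = P 1 2 ^ 2)
    (hA : minor w 0 1 * minor w 2 3 = (ε : ℤ) * (P 0 1 * P 2 3))
    (hB : minor w 0 2 * minor w 1 3 = (ε : ℤ) * (P 0 2 * P 1 3))
    (hC : minor w 0 3 * minor w 1 2 = (ε : ℤ) * (P 0 3 * P 1 2)) :
    ∃ (t : Fin 4 → ℤˣ) (δ : ℤˣ), ∀ i j, i < j →
      minor w i j = ((δ * (t i * t j) : ℤˣ) : ℤ) * P i j := by
  obtain ⟨σ, a1, a2⟩ := exists_signs_of_mul_eq h01 h23 hA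
  obtain ⟨τ, b1, b2⟩ := exists_signs_of_mul_eq h02 h13 hB
  obtain ⟨ρ, c1, c2⟩ := exists_signs_of_mul_eq h03 h12 hC
  have e1 : ∀ ε σ τ ρ : ℤˣ, ε * σ * τ * ρ * (1 * (ε * σ * τ * ρ * σ)) = σ := by decide
  have e2 : ∀ ε σ τ ρ : ℤˣ, ε * σ * τ * ρ * (1 * (ε * σ * τ * ρ * τ)) = τ := by decide
  have e3 : ∀ ε σ τ ρ : ℤˣ, ε * σ * τ * ρ * (1 * (ε * σ * τ * ρ * ρ)) = ρ := by decide
  have e4 : ∀ ε σ τ ρ : ℤˣ,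
      ε * σ * τ * ρ * (ε * σ * τ * ρ * σ * (ε * σ * τ * ρ * τ)) = ε * ρ := by decide
  have e5 : ∀ ε σ τ ρ : ℤˣ,
      ε * σ * τ * ρ * (ε * σ * τ * ρ * σ * (ε * σ * τ * ρ * ρ)) = ε * τ := by decide
  have e6 : ∀ ε σ τ ρ : ℤˣ,
      ε * σ * τ * ρ * (ε * σ * τ * ρ * τ * (ε * σ * τ * ρ * ρ)) = ε * σ := by decide
  -- Normalising `t₀ = 1`, the pairs `01`, `02`, `03` force `t₁ = δσ`, `t₂ = δτ`, `t₃ = δρ`. The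
  -- pair `12` then requires `δστ = ερ`, that is `δ = εστρ`, and the pairs `13` and `23` give the
  -- same value.
  refine ⟨![1, ε * σ * τ * ρ * σ, ε * σ * τ * ρ * τ, ε * σ * τ * ρ * ρ], ε * σ * τ * ρ,
    fun i j hij => ?_⟩
  fin_cases i <;> fin_cases j <;> first
    | exact absurd hij (by decide)
    | exact a1.trans (congrArg (fun s : ℤˣ => ((s : ℤ) : ℝ) * P 0 1) (e1 ε σ τ ρ).symm)
    | exact b1.trans (congrArg (fun s : ℤˣ => ((s : ℤ) : ℝ) * P 0 2) (e2 ε σ τ ρ).symm)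
    | exact c1.trans (congrArg (fun s : ℤˣ => ((s : ℤ) : ℝ) * P 0 3) (e3 ε σ τ ρ).symm)
    | exact c2.trans (congrArg (fun s : ℤˣ => ((s : ℤ) : ℝ) * P 1 2) (e4 ε σ τ ρ).symm)
    | exact b2.trans (congrArg (fun s : ℤˣ => ((s : ℤ) : ℝ) * P 1 3) (e5 ε σ τ ρ).symm)
    | exact a2.trans (congrArg (fun s : ℤˣ => ((s : ℤ) : ℝ) * P 2 3) (e6 ε σ τ ρ).symm)

/-- The map from frames to `ℝ³ × ℂ` whose first part is the moment map, up to a factor, and whose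
second part doubles the angle of the cross-ratio parameter. -/
noncomputable def frameVec (v : Frame 4 2) : EuclideanSpace ℝ (Fin 5) :=
  realComplexVec (minor v.1 0 1 ^ 2 - minor v.1 2 3 ^ 2) (minor v.1 0 2 ^ 2 - minor v.1 1 3 ^ 2)
    (minor v.1 0 3 ^ 2 - minor v.1 1 2 ^ 2)
    (angleDouble ⟨minor v.1 0 1 * minor v.1 2 3, minor v.1 0 3 * minor v.1 1 2⟩)

theorem continuous_frameVec : Continuous frameVec := by
  have hm : ∀ i j, Continuous fun v : Frame 4 2 => minor v.1 i j := by
    intro i j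
    have hv : ∀ m i, Continuous fun v : Frame 4 2 => v.1 m i := fun m i =>
      (continuous_apply_apply m i).comp continuous_subtype_val
    exact ((hv 0 i).mul (hv 1 j)).sub ((hv 0 j).mul (hv 1 i))
  unfold frameVec
  apply Continuous.realComplexVec
  · fun_prop
  · fun_prop
  · fun_prop
  · exact continuous_angleDouble.comp (Complex.equivRealProdCLM.symm.continuous.comp
      (((hm 0 1).mul (hm 2 3)).prodMk ((hm 0 3).mul (hm 1 2))))

/-- If the value is zero, the Plücker relation makes the third product of complementary minors
vanish too, and then every minor vanishes. -/
theorem frameVec_ne_zero (v : Frame 4 2) : frameVec v ≠ 0 := by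
  intro h
  rw [frameVec, ← realComplexVec_zero, realComplexVec_inj] at h
  obtain ⟨h0, h1, h2, h3⟩ := h
  have hn := congrArg norm h3
  rw [norm_angleDouble, norm_zero, norm_eq_zero] at hn
  have hA : minor v.1 0 1 * minor v.1 2 3 = 0 := congrArg Complex.re hn
  have hC : minor v.1 0 3 * minor v.1 1 2 = 0 := congrArg Complex.im hn
  have hB : minor v.1 0 2 * minor v.1 1 3 = 0 := by
    linear_combination hA + hC - minor_plucker v.1 0 1 2 3
  have key : ∀ x y : ℝ, x ^ 2 - y ^ 2 = 0 → x * y = 0 → x = 0 ∧ y = 0 := by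
    intro x y h h'
    have := sq_eq_of_sq_sub_sq_eq (x := x) (y := y) (a := 0) (b := 0) (by simpa using h)
      (by simp [h'])
    simpa using this
  obtain ⟨h01, h23⟩ := key _ _ h0 hA
  obtain ⟨h02, h13⟩ := key _ _ h1 hB
  obtain ⟨h03, h12⟩ := key _ _ h2 hC
  have := exists_minor_ne_zero v
  simp [h01, h02, h03, h12, h13, h23] at this

theorem exists_frameVec_eq_smul {y : EuclideanSpace ℝ (Fin 5)} (hy : y ≠ 0) :
    ∃ v, ∃ k : ℝ, 0 < k ∧ frameVec v = k • y := by
  obtain ⟨a, b, c, w, rfl⟩ := exists_eq_realComplexVec y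
  obtain ⟨z, rfl⟩ := angleDouble_surjective w
  obtain ⟨p01, p23, h0, hA⟩ := exists_sq_sub_sq_eq a z.re
  -- The product `z.re + z.im` is dictated by the Plücker relation.
  obtain ⟨p02, p13, h1, hB⟩ := exists_sq_sub_sq_eq b (z.re + z.im)
  obtain ⟨p03, p12, h2, hC⟩ := exists_sq_sub_sq_eq c z.im
  obtain ⟨v, k, hk, q01, q02, q03, q12, q13, q23⟩ := exists_minors_eq
    (p01 := p01) (p02 := p02) (p03 := p03) (p12 := p12) (p13 := p13) (p23 := p23)
    (by rw [hA, hB, hC]; ring) (by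
      by_contra! h
      obtain ⟨h01, h02, h03, h12, h13, h23⟩ := h
      apply hy
      have hz : z = 0 := Complex.ext (by rw [← hA, h01, zero_mul]; rfl)
        (by rw [← hC, h03, zero_mul]; rfl)
      rw [← h0, ← h1, ← h2, h01, h02, h03, h12, h13, h23, hz, ← realComplexVec_zero]
      simp [angleDouble])
  have hv : LinearIndependent ℝ v := by
    rw [linearIndependent_iff_exists_minor_ne_zero]
    by_contra! h
    apply hy
    simp only [h, zero_eq_mul, hk, false_or] at q01 q02 q03 q12 q13 q23
    have hz : z = 0 := Complex.ext (by rw [← hA, q01, zero_mul]; rfl)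
      (by rw [← hC, q03, zero_mul]; rfl)
    rw [← h0, ← h1, ← h2, q01, q02, q03, q12, q13, q23, hz, ← realComplexVec_zero]
    simp [angleDouble]
  refine ⟨⟨v, hv⟩, k ^ 2, by positivity, ?_⟩
  have hz : (⟨k * p01 * (k * p23), k * p03 * (k * p12)⟩ : ℂ) = (k ^ 2 : ℝ) * z := by
    apply Complex.ext
    · rw [Complex.re_ofReal_mul, ← hA]
      ring
    · rw [Complex.im_ofReal_mul, ← hC]
      ring
  rw [frameVec, smul_realComplexVec, realComplexVec_inj, q01, q02, q03, q12, q13, q23, hz,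
    angleDouble_real_mul, abs_of_nonneg (sq_nonneg k), ← h0, ← h1, ← h2]
  refine ⟨?_, ?_, ?_, rfl⟩ <;> ring

/-- `frameVec` has degree two in the minors; the signs cancel in the squares and leave the common
factor `t₀t₁t₂t₃` in the complex part, where angle doubling removes it. -/
theorem frameVec_eq_smul_of_minors {v w : Frame 4 2} {t : Fin 4 → ℤˣ} {k : ℝ}
    (h : ∀ i j, minor w.1 i j = k * (((t i * t j : ℤˣ) : ℤ) * minor v.1 i j)) :
    frameVec w = k ^ 2 • frameVec v := by
  have hsq : ∀ i j, minor w.1 i j ^ 2 = k ^ 2 * minor v.1 i j ^ 2 := by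
    intro i j
    rw [h]
    linear_combination (k ^ 2 * minor v.1 i j ^ 2) * sign_mul_self (t i * t j)
  have hz : (⟨minor w.1 0 1 * minor w.1 2 3, minor w.1 0 3 * minor w.1 1 2⟩ : ℂ) =
      (k ^ 2 * ((t 0 * t 1 * t 2 * t 3 : ℤˣ) : ℤ) : ℝ) *
        ⟨minor v.1 0 1 * minor v.1 2 3, minor v.1 0 3 * minor v.1 1 2⟩ := by
    apply Complex.ext
    · rw [Complex.re_ofReal_mul]
      simp only [h]
      push_cast
      ring
    · rw [Complex.im_ofReal_mul]
      simp only [h]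
      push_cast
      ring
  have habs : |k ^ 2 * ((t 0 * t 1 * t 2 * t 3 : ℤˣ) : ℤ)| = k ^ 2 := by
    rcases Int.units_eq_one_or (t 0 * t 1 * t 2 * t 3) with h | h <;> rw [h] <;> simp
  rw [frameVec, frameVec, smul_realComplexVec, realComplexVec_inj, hz, angleDouble_real_mul, habs]
  simp only [hsq]
  refine ⟨?_, ?_, ?_, trivial⟩ <;> ring

theorem exists_minors_of_frameVec_eq_smul {v w : Frame 4 2} {k : ℝ} (hk : 0 < k)
    (h : frameVec w = k • frameVec v) : ∃ (t : Fin 4 → ℤˣ) (c : ℝ), c ≠ 0 ∧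
      ∀ i j, minor w.1 i j = c * (((t i * t j : ℤˣ) : ℤ) * minor v.1 i j) := by
  rw [frameVec, frameVec, smul_realComplexVec, realComplexVec_inj] at h
  obtain ⟨h0, h1, h2, h3⟩ := h
  have hz := angleDouble_real_mul k ⟨minor v.1 0 1 * minor v.1 2 3, minor v.1 0 3 * minor v.1 1 2⟩
  rw [abs_of_pos hk, ← h3, eq_comm, angleDouble_eq_iff] at hz
  obtain ⟨ε, hε⟩ : ∃ ε : ℤˣ, (⟨minor w.1 0 1 * minor w.1 2 3, minor w.1 0 3 * minor w.1 1 2⟩ : ℂ) =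
      (((ε : ℤ) * k : ℝ) : ℂ) *
        ⟨minor v.1 0 1 * minor v.1 2 3, minor v.1 0 3 * minor v.1 1 2⟩ := by
    rcases hz with hz | hz
    · exact ⟨1, by simpa using hz⟩
    · exact ⟨-1, by simpa using hz⟩
  have hA := congrArg Complex.re hε
  have hC := congrArg Complex.im hε
  rw [Complex.re_ofReal_mul] at hA
  rw [Complex.im_ofReal_mul] at hC
  simp only at hA hC
  -- Degree two again: a factor `k` of the invariants is a factor `√k` of the minors.
  obtain ⟨m, hm, hmk⟩ : ∃ m : ℝ, 0 < m ∧ m * m = k :=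
    ⟨√k, Real.sqrt_pos.2 hk, Real.mul_self_sqrt hk.le⟩
  subst hmk
  let P : Fin 4 → Fin 4 → ℝ := fun i j => m * minor v.1 i j
  have eA : minor w.1 0 1 * minor w.1 2 3 = (ε : ℤ) * (P 0 1 * P 2 3) := by
    linear_combination hA
  have eC : minor w.1 0 3 * minor w.1 1 2 = (ε : ℤ) * (P 0 3 * P 1 2) := by
    linear_combination hC
  have eB : minor w.1 0 2 * minor w.1 1 3 = (ε : ℤ) * (P 0 2 * P 1 3) := by
    linear_combination hA + hC - minor_plucker w.1 0 1 2 3 +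
      (ε : ℤ) * m ^ 2 * minor_plucker v.1 0 1 2 3
  have hsq : ∀ {x y : ℝ}, x = (ε : ℤ) * y → x ^ 2 = y ^ 2 := by
    rintro x y rfl
    linear_combination y ^ 2 * sign_mul_self ε
  obtain ⟨h01, h23⟩ := sq_eq_of_sq_sub_sq_eq (a := P 0 1) (b := P 2 3)
    (by linear_combination h0) (hsq eA)
  obtain ⟨h02, h13⟩ := sq_eq_of_sq_sub_sq_eq (a := P 0 2) (b := P 1 3)
    (by linear_combination h1) (hsq eB)
  obtain ⟨h03, h12⟩ := sq_eq_of_sq_sub_sq_eq (a := P 0 3) (b := P 1 2)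
    (by linear_combination h2) (hsq eC)
  obtain ⟨t, δ, ht⟩ := exists_signs_of_minors h01 h23 h02 h13 h03 h12 eA eB eC
  have hδ := sign_mul_self δ
  -- The sign `δ` need not come from the group; it is absorbed in the scalar `c`, which leaves the
  -- plane unchanged.
  refine ⟨t, (δ : ℤ) * m, mul_ne_zero (left_ne_zero_of_mul_eq_one hδ) hm.ne', fun i j => ?_⟩
  rw [forall_minor_eq (v := v.1) (c := fun i j => (δ : ℤ) * m * ((t i * t j : ℤˣ) : ℤ))
    (fun i j => by rw [mul_comm (t i)])]
  · ring
  · intro i j hij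
    rw [ht i j hij]
    push_cast
    ring

theorem nonempty_signOrbitSpace_homeomorph : Nonempty (SignOrbitSpace 4 2 ≃ₜ unitSphere 4) := by
  refine nonempty_homeomorph_unitSphere (isQuotientMap_frameOrbit 4 2) continuous_frameVec
    frameVec_ne_zero (fun y hy => exists_frameVec_eq_smul hy) fun v w => ?_
  rw [frameOrbit_eq_iff]
  constructor
  · rintro ⟨t, k, hk, h⟩
    exact ⟨k ^ 2, by positivity, frameVec_eq_smul_of_minors h⟩
  · rintro ⟨k, hk, h⟩
    exact exists_minors_of_frameVec_eq_smul hk h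

end RealGrassmannian

theorem mainTheorem6 :
    Nonempty (SignOrbitSpace 4 2 ≃ₜ
      Quotient (boundarySetoid (hypersimplex 4 2) (ℙ ℝ (Fin 2 → ℝ)))) ∧
    Nonempty (SignOrbitSpace 4 2 ≃ₜ TopJoin (unitSphere 2) (unitSphere 1)) ∧
    Nonempty (SignOrbitSpace 4 2 ≃ₜ unitSphere 4) := by
  obtain ⟨e⟩ := RealGrassmannian.nonempty_signOrbitSpace_homeomorph
  obtain ⟨f⟩ := nonempty_hypersimplex_quotient_homeomorph
  obtain ⟨g⟩ := nonempty_topJoin_homeomorph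
  exact ⟨⟨e.trans f.symm⟩, ⟨e.trans g.symm⟩, ⟨e⟩⟩
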